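/- Let $\mathbb{F}_{q^m}/\mathbb{F}_q$ be an extension of finite fields of degree $m$, and let $\alpha\in\mathbb{F}_{q^m}$ satisfy $\mathbb{F}_{q^m}=\mathbb{F}_q[\alpha]$. Let $r\ge 0$, $R=\mathbb{F}_{q^m}[X_0,\dots,X_{r-1}]$ and $S=\mathbb{F}_q[x_{i,j} : 0\le i<r,\ 0\le j<m]$. Let $\Phi:R\to\mathbb{F}_{q^m}[x_{i,j}]$ be the homomorphism of $\mathbb{F}_{q^m}$-algebras with $\Phi(X_i)=\sum_{j=0}^{m-1}\alpha^j x_{i,j}$. For $f\in R$, let $\Phi_0(f),\dots,\Phi_{m-1}(f)\in S$ be the unique polynomials with $\Phi(f)=\sum_{j=0}^{m-1}\alpha^j\Phi_j(f)$. The Weil restriction of an ideal $I\subset R$ is the ideal $\mathrm{Res}(I)=\langle \Phi_j(f) : f\in I,\ 0\le j<m\rangle$ of $S$. Let $I\subsetneq R$ be a proper homogeneous ideal. (1) Let $(f_1,\dots,f_N)$ be a minimal set of homogeneous generators of $I$, that is, a finite family of homogeneous polynomials that generates $I$ and no longer generates $I$ when any one member is removed. Then the family $(\Phi_j(f_i))_{1\le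 i\le N,\,0\le j<m}$ is a minimal set of homogeneous generators of $\mathrm{Res}(I)$, in the same sense, and each $\Phi_j(f_i)$ is homogeneous of the same degree as $f_i$. Moreover, for every minimal set of homogeneous generators $(g_1,\dots,g_M)$ of $\mathrm{Res}(I)$ and every $d\ge 0$, the number of $k$ with $\deg g_k=d$ is $m$ times the number of $i$ with $\deg f_i=d$. (2) If $(f_1,\dots,f_N)$ is a family of (not necessarily homogeneous) polynomials that generates $I$, with $N$ the smallest possible number of generators of $I$, then $(\Phi_j(f_i))_{i,j}$ generates $\mathrm{Res}(I)$, and its number $mN$ of members is the smallest possible number of generators of $\mathrm{Res}(I)$. -/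

import Mathlib

open MvPolynomial

namespace WeilRes

noncomputable section

variable {F K : Type*} [Field F] [Field K] [Algebra F K]

/-- The homomorphism of `K`-algebras `K[X₀, …, X_{r-1}] → K[x_{i,j}]` that sends `X_i` to
`∑_{0 ≤ j < m} α ^ j x_{i,j}`, where `α = pb.gen` and `m = pb.dim = [K : F]`. -/
def split (pb : PowerBasis F K) (r : ℕ) :
    MvPolynomial (Fin r) K →ₐ[K] MvPolynomial (Fin r × Fin pb.dim) K :=
  aeval fun i => ∑ j : Fin pb.dim, C (pb.gen ^ (j : ℕ)) * X (i, j)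

/-- The polynomial over `F` whose coefficients are the coordinates along `α ^ j`, in the basis
`(1, α, …, α ^ (m - 1))` of `K` over `F`, of the coefficients of `p`. -/
def coordPoly {σ : Type*} (pb : PowerBasis F K) (j : Fin pb.dim) (p : MvPolynomial σ K) :
    MvPolynomial σ F :=
  ∑ s ∈ p.support, monomial s (pb.basis.repr (coeff s p) j)

/-- The component `Φ_j(f)` of `f`. -/
def component (pb : PowerBasis F K) {r : ℕ} (j : Fin pb.dim) (f : MvPolynomial (Fin r) K) :
    MvPolynomial (Fin r × Fin pb.dim) F :=
  coordPoly pb j (split pb r f)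

/-- The Weil restriction of an ideal `I`: the ideal generated by all components `Φ_j(f)`, `f ∈ I`. -/
def restriction (pb : PowerBasis F K) {r : ℕ} (I : Ideal (MvPolynomial (Fin r) K)) :
    Ideal (MvPolynomial (Fin r × Fin pb.dim) F) :=
  Ideal.span {g | ∃ f ∈ I, ∃ j, component pb j f = g}

/-- The family of all components `Φ_j(f_i)` of a family `(f_i)`, indexed by the pairs `(i, j)`. -/
def components (pb : PowerBasis F K) {r : ℕ} {ι : Type*} (f : ι → MvPolynomial (Fin r) K) :
    ι × Fin pb.dim → MvPolynomial (Fin r × Fin pb.dim) F :=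
  fun p => component pb p.2 (f p.1)

/-- `f` is an irredundant generating family of `I`: it generates `I`, and no longer does so when
any one of its members is left out. -/
structure IsIrredundantGen {A ι : Type*} [CommRing A] (I : Ideal A) (f : ι → A) : Prop where
  span_eq : Ideal.span (Set.range f) = I
  irredundant : ∀ i, Ideal.span (f '' {i}ᶜ) ≠ I

/-- `f` is a family of homogeneous polynomials which is an irredundant generating family of `I`. -/
structure IsMinHomogeneousGen {k σ ι : Type*} [Field k] (I : Ideal (MvPolynomial σ k))
    (f : ι → MvPolynomial σ k) : Prop extends IsIrredundantGen I f where
  homogeneous : ∀ i, ∃ d, (f i).IsHomogeneous d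

/-- `f` is a finite generating family of `I` with the smallest possible number of members. -/
structure IsMinCardGen {A ι : Type*} [CommRing A] [Fintype ι] (I : Ideal A) (f : ι → A) :
    Prop where
  span_eq : Ideal.span (Set.range f) = I
  card_le : ∀ (n : ℕ) (g : Fin n → A), Ideal.span (Set.range g) = I → Fintype.card ι ≤ n

theorem coeff_coordPoly {σ : Type*} (pb : PowerBasis F K) (j : Fin pb.dim)
    (p : MvPolynomial σ K) (s : σ →₀ ℕ) :
    coeff s (coordPoly pb j p) = pb.basis.repr (coeff s p) j := by
  classical
  rw [coordPoly, coeff_sum]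
  simp only [coeff_monomial]
  rw [Finset.sum_ite_eq' p.support s]
  split_ifs with h
  · rfl
  · rw [notMem_support_iff.mp h]; simp

/-- The components are characterised by `Φ(f) = ∑_j α ^ j Φ_j(f)` with every `Φ_j(f)` over `F`. -/
theorem split_eq_iff (pb : PowerBasis F K) {r : ℕ} (f : MvPolynomial (Fin r) K)
    (g : Fin pb.dim → MvPolynomial (Fin r × Fin pb.dim) F) :
    split pb r f = ∑ j : Fin pb.dim, C (pb.gen ^ (j : ℕ)) * map (algebraMap F K) (g j) ↔
      ∀ j, g j = component pb j f := by
  have key : ∀ s, coeff s (∑ j : Fin pb.dim, C (pb.gen ^ (j : ℕ)) * map (algebraMap F K) (g j))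
      = ∑ j : Fin pb.dim, coeff s (g j) • pb.basis j := by
    intro s
    rw [coeff_sum]
    refine Finset.sum_congr rfl fun j _ => ?_
    rw [coeff_C_mul, coeff_map, pb.basis_eq_pow, Algebra.smul_def, mul_comm]
  constructor
  · intro h j
    ext s
    rw [component, coeff_coordPoly, h, key, pb.basis.repr_sum_self]
  · intro h
    ext s
    rw [key]
    conv_lhs => rw [← pb.basis.sum_repr (coeff s (split pb r f))]
    refine Finset.sum_congr rfl fun j _ => ?_
    rw [h j, component, coeff_coordPoly]

end

end WeilRes

attribute [local instance] MvPolynomial.gradedAlgebra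

namespace WeilRes

noncomputable section

/-! Write `𝔪`, `𝔫` for the ideals of polynomials without constant term in `R`, `S`. By graded
Nakayama, a homogeneous generating family of `I` is irredundant iff it is independent modulo `𝔪I`
(`IsMinHomogeneousGen.indepMod`, `IndepMod.isIrredundantGen`). The components of generators of `I`
generate `Res(I)` (`restriction_span_range`), so what remains is their independence modulo `𝔫
Res(I)`.

For this, let `β` be the trace dual of the basis `(α ^ j)`, and let `project` substitute `β_j X_i`
for `x_{i,j}`. Since `Φ_j(f) = ∑_τ τ(β_j Φ(f))` over the Galois group and `∑_j τ(α ^ j) β_j` is `1`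
for `τ = 1` and `0` otherwise, `Φ_j(f)` goes to `β_j f` whenever `f` has no constant term
(`project_map_component`). Hence `𝔫 Res(I)` goes into `𝔪I`, and a relation with coefficients `c i j`
goes to one with coefficients `∑_j c i j β_j`. These vanish, and then so do all `c i j`, because `β`
is a basis (`IndepMod.components`). The counts in both parts follow by linear algebra modulo `𝔪I`
and `𝔫 Res(I)`. -/

/-- The ideal of polynomials without constant term. -/
abbrev irrelevant (k σ : Type*) [Field k] : Ideal (MvPolynomial σ k) :=
  RingHom.ker (constantCoeff : MvPolynomial σ k →+* k)

/-- No nontrivial `k`-linear combination of the family `v` lies in `J`. -/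
def IndepMod {k σ ι : Type*} [Field k] [Fintype ι] (J : Ideal (MvPolynomial σ k))
    (v : ι → MvPolynomial σ k) : Prop :=
  ∀ c : ι → k, ∑ i, C (c i) * v i ∈ J → c = 0

/-! ### Graded Nakayama and minimal generators of homogeneous ideals -/

section Graded

variable {k σ ι κ : Type*} [Field k]

theorem coe_decompose_eq (p : MvPolynomial σ k) (i : ℕ) :
    (DirectSum.decompose (homogeneousSubmodule σ k) p i : MvPolynomial σ k) =
      homogeneousComponent i p :=
  decomposition.decompose'_apply p i

theorem irrelevant_isHomogeneous :
    (irrelevant k σ).IsHomogeneous (homogeneousSubmodule σ k) := by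
  intro i p hp
  rw [coe_decompose_eq]
  rw [RingHom.mem_ker, constantCoeff_eq] at hp ⊢
  rw [coeff_homogeneousComponent, hp, ite_self]

theorem isHomogeneous_span_range {v : ι → MvPolynomial σ k}
    (hv : ∀ i, ∃ d, (v i).IsHomogeneous d) :
    (Ideal.span (Set.range v)).IsHomogeneous (homogeneousSubmodule σ k) := by
  refine Ideal.homogeneous_span _ _ ?_
  rintro _ ⟨i, rfl⟩
  exact hv i

theorem homogeneousComponent_mul_of_isHomogeneous {d : ℕ} {f : MvPolynomial σ k}
    (hf : f.IsHomogeneous d) (p : MvPolynomial σ k) :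
    homogeneousComponent d (p * f) = C (constantCoeff p) * f := by
  have h := DirectSum.coe_decompose_mul_of_right_mem_of_le (homogeneousSubmodule σ k)
    (a := p) (b := f) hf (le_refl d)
  rw [coe_decompose_eq, coe_decompose_eq, Nat.sub_self,
    homogeneousComponent_zero] at h
  exact h

theorem le_irrelevant {I : Ideal (MvPolynomial σ k)}
    (hI : I.IsHomogeneous (homogeneousSubmodule σ k)) (hI' : I ≠ ⊤) :
    I ≤ irrelevant k σ := by
  intro f hf
  by_contra h
  have h0 := homogeneousComponent_mem_of_mem hI hf 0
  rw [homogeneousComponent_zero] at h0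
  refine hI' (Ideal.eq_top_of_isUnit_mem _ h0 ?_)
  exact (isUnit_iff_ne_zero.mpr h).map C

variable [Fintype ι] [Fintype κ]

/-- Modulo `𝔪I`, a member of `I` is a `k`-linear combination of generators. -/
theorem exists_sub_sum_mem {I : Ideal (MvPolynomial σ k)} {v : ι → MvPolynomial σ k}
    (hv : Ideal.span (Set.range v) = I) {x : MvPolynomial σ k} (hx : x ∈ I) :
    ∃ a : ι → k, x - ∑ i, C (a i) * v i ∈ irrelevant k σ * I := by
  rw [← hv] at hx
  obtain ⟨c, rfl⟩ := Ideal.mem_span_range_iff_exists_fun.mp hx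
  refine ⟨fun i => constantCoeff (c i), ?_⟩
  rw [← Finset.sum_sub_distrib]
  refine Ideal.sum_mem _ fun i _ => ?_
  rw [← sub_mul]
  refine Ideal.mul_mem_mul ?_ (hv ▸ Ideal.subset_span ⟨i, rfl⟩)
  simp [RingHom.mem_ker]

theorem exists_eq_sum_of_mem_irrelevant_mul {I : Ideal (MvPolynomial σ k)}
    {v : ι → MvPolynomial σ k} (hv : Ideal.span (Set.range v) = I) {x : MvPolynomial σ k}
    (hx : x ∈ irrelevant k σ * I) :
    ∃ a : ι → MvPolynomial σ k, (∀ i, constantCoeff (a i) = 0) ∧ x = ∑ i, a i * v i := by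
  induction hx using Submodule.mul_induction_on' with
  | mem_mul_mem m hm n hn =>
    rw [← hv] at hn
    obtain ⟨c, rfl⟩ := Ideal.mem_span_range_iff_exists_fun.mp hn
    refine ⟨fun i => m * c i, fun i => ?_, ?_⟩
    · rw [map_mul, RingHom.mem_ker.mp hm, zero_mul]
    · rw [Finset.mul_sum]; simp only [mul_assoc]
  | add x _ y _ hx hy =>
    obtain ⟨a, ha, rfl⟩ := hx
    obtain ⟨b, hb, rfl⟩ := hy
    exact ⟨a + b, fun i => by simp [ha, hb], by simp [add_mul, Finset.sum_add_distrib]⟩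

/-- Graded Nakayama: an irredundant homogeneous generating family is independent modulo `𝔪I`. -/
theorem IsMinHomogeneousGen.indepMod {I : Ideal (MvPolynomial σ k)} {v : ι → MvPolynomial σ k}
    (h : IsMinHomogeneousGen I v) : IndepMod (irrelevant k σ * I) v := by
  classical
  intro c hc
  obtain ⟨a, ha, hca⟩ := exists_eq_sum_of_mem_irrelevant_mul h.span_eq hc
  by_contra hne
  obtain ⟨i, hi⟩ := Function.ne_iff.mp hne
  obtain ⟨d, hd⟩ := h.homogeneous i
  set J := Ideal.span (v '' {i}ᶜ) with hJ
  have hJhom : J.IsHomogeneous (homogeneousSubmodule σ k) := by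
    refine Ideal.homogeneous_span _ _ ?_
    rintro _ ⟨l, -, rfl⟩
    exact h.homogeneous l
  have hmem : ∀ l, l ≠ i → v l ∈ J := fun l hl => Ideal.subset_span ⟨l, hl, rfl⟩
  -- Each `a l` has no constant term, so the degree `d` part of this product is `c i` times `v i`,
  -- and `c i` is invertible.
  have h1 : (C (c i) - a i) * v i ∈ J := by
    have h2 : ∑ l, (C (c l) - a l) * v l = 0 := by
      simp only [sub_mul, Finset.sum_sub_distrib, hca, sub_self]
    rw [← Finset.add_sum_erase _ _ (Finset.mem_univ i)] at h2
    rw [eq_neg_of_add_eq_zero_left h2]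
    exact J.neg_mem (Ideal.sum_mem _ fun l hl =>
      J.mul_mem_left _ (hmem l (Finset.ne_of_mem_erase hl)))
  have h3 := homogeneousComponent_mem_of_mem hJhom h1 d
  rw [homogeneousComponent_mul_of_isHomogeneous hd, map_sub, ha, constantCoeff_C, sub_zero] at h3
  have h4 : v i ∈ J := by
    have := J.mul_mem_left (C (c i)⁻¹) h3
    rwa [← mul_assoc, ← C_mul, inv_mul_cancel₀ hi, C_1, one_mul] at this
  refine h.irredundant i (le_antisymm ?_ ?_)
  · rw [← h.span_eq]; exact Ideal.span_mono (Set.image_subset_range _ _)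
  · rw [← h.span_eq, Ideal.span_le]
    rintro _ ⟨l, rfl⟩
    by_cases hl : l = i
    · rw [hl]; exact h4
    · exact hmem l hl

theorem sum_dite_mul_eq_sum_subtype (p : ι → Prop) [DecidablePred p] [Fintype {i // p i}]
    (c : {i // p i} → k) (v : ι → MvPolynomial σ k) :
    ∑ i, C (if hi : p i then c ⟨i, hi⟩ else 0) * v i = ∑ i : {i // p i}, C (c i) * v i := by
  rw [← Finset.sum_filter_add_sum_filter_not Finset.univ p, Finset.sum_subtype _ (p := p) (by simp),
    Finset.sum_eq_zero (s := Finset.univ.filter fun i => ¬ p i), add_zero]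
  · exact Finset.sum_congr rfl fun i _ => by rw [dif_pos i.2]
  · intro i hi
    rw [dif_neg (Finset.mem_filter.mp hi).2, C_0, zero_mul]

/-- A redundant member would be, modulo `𝔪I`, a `k`-combination of the others. This direction needs
no homogeneity. -/
theorem IndepMod.isIrredundantGen {I : Ideal (MvPolynomial σ k)} {v : ι → MvPolynomial σ k}
    (hv : Ideal.span (Set.range v) = I) (h : IndepMod (irrelevant k σ * I) v) :
    IsIrredundantGen I v := by
  classical
  refine ⟨hv, fun i hi => ?_⟩
  have hvi : v i ∈ Ideal.span (Set.range fun l : ({i}ᶜ : Set ι) => v l) := by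
    rw [show (Set.range fun l : ({i}ᶜ : Set ι) => v l) = v '' {i}ᶜ by rw [Set.image_eq_range], hi,
      ← hv]
    exact Ideal.subset_span ⟨i, rfl⟩
  obtain ⟨a, ha⟩ := exists_sub_sum_mem (I := I) (v := fun l : ({i}ᶜ : Set ι) => v l)
    (by rw [← hi, Set.image_eq_range]) (by rwa [← hi, Set.image_eq_range])
  have h0 := h (fun l => (Pi.single i 1 : ι → k) l -
    if hl : l ∈ ({i}ᶜ : Set ι) then a ⟨l, hl⟩ else 0) (by
      simp only [map_sub, sub_mul, Finset.sum_sub_distrib]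
      rw [sum_dite_mul_eq_sum_subtype, Finset.sum_eq_single i]
      · simpa using ha
      · intro l _ hl
        rw [Pi.single_eq_of_ne hl, C_0, zero_mul]
      · simp)
  simpa using congrFun h0 i

/-- A family independent modulo `J` that is congruent to combinations of a family `w` has at most
as many members as `w`. -/
theorem IndepMod.card_le {J : Ideal (MvPolynomial σ k)} {v : ι → MvPolynomial σ k}
    {w : κ → MvPolynomial σ k} (hv : IndepMod J v) (A : ι → κ → k)
    (hA : ∀ i, v i - ∑ l, C (A i l) * w l ∈ J) : Fintype.card ι ≤ Fintype.card κ := by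
  -- A linear relation among the rows of `A` gives the same relation among the `v i` modulo `J`.
  have hli : LinearIndependent k A := by
    rw [Fintype.linearIndependent_iff]
    intro c hc
    refine congrFun (hv c ?_)
    have h1 : ∑ i, C (c i) * (v i - ∑ l, C (A i l) * w l) ∈ J :=
      Ideal.sum_mem _ fun i _ => J.mul_mem_left _ (hA i)
    have h2 : ∑ i, C (c i) * ∑ l, C (A i l) * w l = 0 := by
      simp only [Finset.mul_sum]
      rw [Finset.sum_comm]
      refine Finset.sum_eq_zero fun l _ => ?_
      simp only [← mul_assoc, ← C_mul, ← Finset.sum_mul, ← map_sum]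
      have := congrFun hc l
      simp only [Finset.sum_apply, Pi.smul_apply, smul_eq_mul, Pi.zero_apply] at this
      rw [this, C_0, zero_mul]
    simpa only [mul_sub, Finset.sum_sub_distrib, h2, sub_zero] using h1
  simpa using hli.fintype_card_le_finrank

theorem IndepMod.subtype {J : Ideal (MvPolynomial σ k)} {v : ι → MvPolynomial σ k}
    (hv : IndepMod J v) (p : ι → Prop) [Fintype {i // p i}] :
    IndepMod J fun i : {i // p i} => v i := by
  classical
  intro c hc
  have := hv (fun i => if hi : p i then c ⟨i, hi⟩ else 0) (by
    rwa [sum_dite_mul_eq_sum_subtype])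
  ext i
  simpa [i.2] using congrFun this i

theorem IndepMod.ne_zero {J : Ideal (MvPolynomial σ k)} {v : ι → MvPolynomial σ k}
    (hv : IndepMod J v) (i : ι) : v i ≠ 0 := by
  classical
  intro h
  have := congrFun (hv (Pi.single i 1) ?_) i
  · simp at this
  · rw [Finset.sum_eq_zero]
    · exact J.zero_mem
    · intro l _
      by_cases hl : l = i
      · rw [hl, h, mul_zero]
      · rw [Pi.single_eq_of_ne hl, C_0, zero_mul]

theorem homogeneousComponent_eq_ite {f : MvPolynomial σ k} (hf : ∃ d, f.IsHomogeneous d)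
    (hf0 : f ≠ 0) (d : ℕ) : homogeneousComponent d f = if f.totalDegree = d then f else 0 := by
  obtain ⟨e, he⟩ := hf
  rw [he.totalDegree hf0, homogeneousComponent_of_mem ((mem_homogeneousSubmodule e f).mpr he)]
  simp only [eq_comm]

/-- As `𝔪I` is homogeneous, the degree `d` part of a congruence expressing `v i` through `w`
involves only the `w l` of degree `d`; `IndepMod.card_le` then applies degree by degree. -/
theorem IsMinHomogeneousGen.card_degree_le {I : Ideal (MvPolynomial σ k)}
    {v : ι → MvPolynomial σ k} {w : κ → MvPolynomial σ k} (hv : IsMinHomogeneousGen I v)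
    (hw : IsMinHomogeneousGen I w) (d : ℕ) :
    Nat.card {i // (v i).totalDegree = d} ≤ Nat.card {l // (w l).totalDegree = d} := by
  classical
  have hhom : (irrelevant k σ * I).IsHomogeneous (homogeneousSubmodule σ k) := by
    refine Ideal.IsHomogeneous.mul (irrelevant_isHomogeneous (k := k) (σ := σ)) ?_
    rw [← hv.span_eq]
    exact isHomogeneous_span_range hv.homogeneous
  choose A hA using fun i => exists_sub_sum_mem hw.span_eq (x := v i)
    (hv.span_eq ▸ Ideal.subset_span ⟨i, rfl⟩)
  rw [Nat.card_eq_fintype_card, Nat.card_eq_fintype_card]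
  refine (hv.indepMod.subtype fun i => (v i).totalDegree = d).card_le
    (w := fun l : {l // (w l).totalDegree = d} => w l) (fun i l => A i l) fun i => ?_
  have h := homogeneousComponent_mem_of_mem hhom (hA i) d
  rw [map_sub, map_sum, homogeneousComponent_eq_ite (hv.homogeneous i) (hv.indepMod.ne_zero i),
    if_pos i.2] at h
  convert h using 2
  simp only [homogeneousComponent_C_mul,
    homogeneousComponent_eq_ite (hw.homogeneous _) (hw.indepMod.ne_zero _), mul_ite, mul_zero]
  rw [← Finset.sum_filter]
  exact (Finset.sum_subtype (Finset.univ.filter fun l => (w l).totalDegree = d) (by simp)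
    fun l => C (A i l) * w l).symm

theorem IsMinHomogeneousGen.card_degree_eq {I : Ideal (MvPolynomial σ k)}
    {v : ι → MvPolynomial σ k} {w : κ → MvPolynomial σ k} (hv : IsMinHomogeneousGen I v)
    (hw : IsMinHomogeneousGen I w) (d : ℕ) :
    Nat.card {i // (v i).totalDegree = d} = Nat.card {l // (w l).totalDegree = d} :=
  le_antisymm (hv.card_degree_le hw d) (hw.card_degree_le hv d)

end Graded

/-- Noetherianity gives a finite homogeneous generating family; one of least length is irredundant.
-/
theorem exists_isMinHomogeneousGen {k σ : Type*} [Field k] [Finite σ]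
    {I : Ideal (MvPolynomial σ k)} (hI : I.IsHomogeneous (homogeneousSubmodule σ k)) :
    ∃ (n : ℕ) (v : Fin n → MvPolynomial σ k), IsMinHomogeneousGen I v := by
  classical
  have hex : ∃ n, ∃ v : Fin n → MvPolynomial σ k, Ideal.span (Set.range v) = I ∧
      ∀ i, ∃ d, (v i).IsHomogeneous d := by
    obtain ⟨S, hS⟩ := (Ideal.IsHomogeneous.iff_exists _ _).mp hI
    have hfg : I.FG := IsNoetherian.noetherian I
    rw [hS] at hfg
    obtain ⟨t, htS, ht⟩ := (Submodule.fg_span_iff_fg_span_finset_subset _).mp hfg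
    refine ⟨t.card, fun i => t.equivFin.symm i, ?_, fun i => ?_⟩
    · rw [hS]
      refine Eq.trans ?_ ht.symm
      congr 1
      ext x
      constructor
      · rintro ⟨i, rfl⟩; exact (t.equivFin.symm i).2
      · intro hx; exact ⟨t.equivFin ⟨x, hx⟩, by simp⟩
    · obtain ⟨⟨x, d, hx⟩, -, h⟩ := htS (t.equivFin.symm i).2
      exact ⟨d, by beta_reduce; rw [← h]; exact hx⟩
  obtain ⟨v, hv, hhom⟩ := Nat.find_spec hex
  refine ⟨_, v, ⟨⟨hv, fun i hi => ?_⟩, hhom⟩⟩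
  have hpos : 0 < Nat.find hex := i.pos
  have hcard : Fintype.card ({i}ᶜ : Set (Fin (Nat.find hex))) = Nat.find hex - 1 := by
    rw [Fintype.card_compl_set]; simp
  refine Nat.find_min hex (m := Nat.find hex - 1) (by omega) ?_
  let e := Fintype.equivFinOfCardEq hcard
  refine ⟨fun l => v (e.symm l), ?_, fun l => hhom _⟩
  refine Eq.trans ?_ hi
  rw [Set.image_eq_range]
  congr 1
  exact e.symm.surjective.range_comp (fun x => v x)

/-! ### Components of polynomials and generators of the Weil restriction -/

section Components

variable {F K : Type*} [Field F] [Field K] [Algebra F K] {σ : Type*}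

theorem coordPoly_add (pb : PowerBasis F K) (j : Fin pb.dim) (p q : MvPolynomial σ K) :
    coordPoly pb j (p + q) = coordPoly pb j p + coordPoly pb j q := by
  ext s
  simp [coeff_coordPoly]

/-- The coordinates along `α ^ j` as an additive map. -/
def coordPolyHom (pb : PowerBasis F K) (j : Fin pb.dim) :
    MvPolynomial σ K →+ MvPolynomial σ F :=
  AddMonoidHom.mk' (coordPoly pb j) (coordPoly_add pb j)

theorem coordPoly_sum (pb : PowerBasis F K) (j : Fin pb.dim) {ι : Type*} (t : Finset ι)
    (p : ι → MvPolynomial σ K) :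
    coordPoly pb j (∑ i ∈ t, p i) = ∑ i ∈ t, coordPoly pb j (p i) :=
  map_sum (coordPolyHom pb j) p t

theorem coordPoly_mul_map (pb : PowerBasis F K) (j : Fin pb.dim) (p : MvPolynomial σ K)
    (q : MvPolynomial σ F) :
    coordPoly pb j (p * map (algebraMap F K) q) = coordPoly pb j p * q := by
  classical
  ext s
  rw [coeff_coordPoly, coeff_mul, coeff_mul, map_sum, Finsupp.finsetSum_apply]
  refine Finset.sum_congr rfl fun x _ => ?_
  rw [coeff_map, coeff_coordPoly, mul_comm, ← Algebra.smul_def, map_smul, Finsupp.smul_apply,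
    smul_eq_mul, mul_comm]

theorem coordPoly_mul_split (pb : PowerBasis F K) {r : ℕ} (j : Fin pb.dim)
    (p : MvPolynomial (Fin r × Fin pb.dim) K) (f : MvPolynomial (Fin r) K) :
    coordPoly pb j (p * split pb r f) =
      ∑ l : Fin pb.dim, coordPoly pb j (p * C (pb.gen ^ (l : ℕ))) * component pb l f := by
  rw [(split_eq_iff pb f fun l => component pb l f).mpr fun _ => rfl, Finset.mul_sum,
    coordPoly_sum]
  refine Finset.sum_congr rfl fun l _ => ?_
  rw [← mul_assoc, coordPoly_mul_map]

/-- For `g = ∑ c_i f_i`, expanding `Φ(f_i) = ∑_l α ^ l Φ_l(f_i)` and taking coordinates, which is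
linear over `S`, writes `Φ_j(g)` as an `S`-combination of the `Φ_l(f_i)`. -/
theorem restriction_span_range (pb : PowerBasis F K) {r : ℕ} {ι : Type*} [Fintype ι]
    (f : ι → MvPolynomial (Fin r) K) :
    Ideal.span (Set.range (components pb f)) =
      restriction pb (Ideal.span (Set.range f)) := by
  apply le_antisymm
  · rw [Ideal.span_le]
    rintro _ ⟨⟨i, j⟩, rfl⟩
    exact Ideal.subset_span ⟨f i, Ideal.subset_span ⟨i, rfl⟩, j, rfl⟩
  · rw [restriction, Ideal.span_le]
    rintro _ ⟨g, hg, j, rfl⟩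
    obtain ⟨c, rfl⟩ := Ideal.mem_span_range_iff_exists_fun.mp hg
    rw [component, map_sum, coordPoly_sum]
    refine Ideal.sum_mem _ fun i _ => ?_
    rw [map_mul, coordPoly_mul_split]
    exact Ideal.sum_mem _ fun l _ => Ideal.mul_mem_left _ _ (Ideal.subset_span ⟨(i, l), rfl⟩)

theorem isHomogeneous_component (pb : PowerBasis F K) {r d : ℕ} {f : MvPolynomial (Fin r) K}
    (hf : f.IsHomogeneous d) (j : Fin pb.dim) : (component pb j f).IsHomogeneous d := by
  have h : (split pb r f).IsHomogeneous (1 * d) := by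
    refine hf.aeval _ fun i => IsHomogeneous.sum _ _ _ fun l _ => isHomogeneous_C_mul_X _ _
  rw [one_mul] at h
  intro s hs
  refine h ?_
  rw [component, coeff_coordPoly] at hs
  intro h0
  rw [h0] at hs
  simp at hs

end Components

/-! ### Trace duality and the projection back to `R` -/

section Galois

variable {F K : Type*} [Field F] [Field K] [Algebra F K] [FiniteDimensional F K] [IsGalois F K]

/-- Trace duality says `D * A = 1` for the conjugate matrices of the two bases. They are square
because `[K : F]` is the order of the Galois group, so `A * D = 1` too; its column at `1` is the
claim. -/
theorem sum_galois_mul_traceDual (pb : PowerBasis F K) (τ : Gal(K/F)) [Decidable (τ = 1)] :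
    ∑ j, τ (pb.basis j) * pb.basis.traceDual j = if τ = 1 then 1 else 0 := by
  classical
  let A : Matrix Gal(K/F) (Fin pb.dim) K := fun τ j => τ (pb.basis j)
  let D : Matrix (Fin pb.dim) Gal(K/F) K := fun j τ => τ (pb.basis.traceDual j)
  have hDA : D * A = 1 := by
    ext i j
    rw [Matrix.mul_apply, Matrix.one_apply]
    have h := congrArg (algebraMap F K) (pb.basis.trace_traceDual_mul i j)
    rw [trace_eq_sum_automorphisms] at h
    simp only [map_mul] at h
    rw [h]
    simp [eq_comm, apply_ite]
  have hcard : Fintype.card (Fin pb.dim) = Fintype.card Gal(K/F) := by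
    rw [Fintype.card_fin, ← pb.finrank, ← IsGalois.card_aut_eq_finrank, Nat.card_eq_fintype_card]
  have hAD := (Matrix.mul_eq_one_comm_of_card_eq _ _ _ hcard).mp hDA
  have h := congrFun (congrFun hAD τ) 1
  rw [Matrix.mul_apply, Matrix.one_apply] at h
  convert h
  rfl

theorem algebraMap_basis_repr (pb : PowerBasis F K) (j : Fin pb.dim) (x : K) :
    algebraMap F K (pb.basis.repr x j) = ∑ τ : Gal(K/F), τ (pb.basis.traceDual j * x) := by
  have h := pb.basis.traceDual.traceDual_repr_apply x j
  rw [Module.Basis.traceDual_traceDual] at h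
  rw [h, Algebra.traceForm_apply, trace_eq_sum_automorphisms, mul_comm]

theorem map_coordPoly {σ : Type*} (pb : PowerBasis F K) (j : Fin pb.dim) (p : MvPolynomial σ K) :
    map (algebraMap F K) (coordPoly pb j p) =
      ∑ τ : Gal(K/F), map (τ : K →+* K) (C (pb.basis.traceDual j) * p) := by
  ext s
  rw [coeff_map, coeff_coordPoly, algebraMap_basis_repr, coeff_sum]
  refine Finset.sum_congr rfl fun τ _ => ?_
  rw [coeff_map, coeff_C_mul]
  rfl

/-- The homomorphism that sends `x_{i,j}` to `β_j X_i`, where `β` is the trace dual of the basis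
`(1, α, …, α ^ (m - 1))`. -/
def project (pb : PowerBasis F K) (r : ℕ) :
    MvPolynomial (Fin r × Fin pb.dim) K →ₐ[K] MvPolynomial (Fin r) K :=
  aeval fun p => C (pb.basis.traceDual p.2) * X p.1

/-- The composite sends `X_i` to `(∑_j τ(α ^ j) β_j) X_i`, so for `τ ≠ 1` every variable dies and
only the constant term survives. -/
theorem project_map_split (pb : PowerBasis F K) {r : ℕ} (τ : Gal(K/F)) [Decidable (τ = 1)]
    (f : MvPolynomial (Fin r) K) :
    project pb r (map (τ : K →+* K) (split pb r f)) =
      if τ = 1 then f else C (τ (constantCoeff f)) := by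
  have hX : ∀ i, project pb r (map (τ : K →+* K) (split pb r (X i))) =
      C (if τ = 1 then 1 else 0) * X i := by
    intro i
    rw [← sum_galois_mul_traceDual pb τ]
    simp [split, project, Finset.sum_mul, mul_assoc]
  have hC : ∀ a, project pb r (map (τ : K →+* K) (split pb r (C a))) = C (τ a) := by
    intro a
    simp [split, project, algebraMap_eq]
  split_ifs with h
  · refine congrFun (congrArg DFunLike.coe (MvPolynomial.ringHom_ext
      (f := ((project pb r).toRingHom.comp (map (τ : K →+* K))).comp (split pb r).toRingHom)
      (g := RingHom.id _) ?_ ?_)) f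
    · intro a
      refine (hC a).trans ?_
      rw [h]; rfl
    · intro i
      refine (hX i).trans ?_
      rw [if_pos h, C_1, one_mul]; rfl
  · refine congrFun (congrArg DFunLike.coe (MvPolynomial.ringHom_ext
      (f := ((project pb r).toRingHom.comp (map (τ : K →+* K))).comp (split pb r).toRingHom)
      (g := (C.comp (τ : K →+* K)).comp constantCoeff) ?_ ?_)) f
    · intro a
      refine (hC a).trans ?_
      simp
    · intro i
      refine (hX i).trans ?_
      simp [h]

theorem project_map_component (pb : PowerBasis F K) {r : ℕ} (j : Fin pb.dim)
    {f : MvPolynomial (Fin r) K} (hf : constantCoeff f = 0) :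
    project pb r (map (algebraMap F K) (component pb j f)) = C (pb.basis.traceDual j) * f := by
  classical
  rw [component, map_coordPoly, map_sum, Finset.sum_eq_single 1]
  · rw [map_mul, map_mul, project_map_split, if_pos rfl]
    simp [project, algebraMap_eq]
  · intro τ _ hτ
    rw [map_mul, map_mul, project_map_split, if_neg hτ, hf]
    simp
  · simp

end Galois

/-! ### Independence of the components and the generator counts -/

section Main

variable {F K : Type*} [Field F] [Field K] [Algebra F K] [FiniteDimensional F K] [IsGalois F K]

theorem project_map_mem (pb : PowerBasis F K) {r : ℕ} {I : Ideal (MvPolynomial (Fin r) K)}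
    (hI : I ≤ irrelevant K (Fin r)) {x : MvPolynomial (Fin r × Fin pb.dim) F}
    (hx : x ∈ restriction pb I) : project pb r (map (algebraMap F K) x) ∈ I := by
  suffices restriction pb I ≤
      I.comap ((project pb r).toRingHom.comp (map (algebraMap F K))) from this hx
  rw [restriction, Ideal.span_le]
  rintro _ ⟨f, hf, j, rfl⟩
  change project pb r (map (algebraMap F K) (component pb j f)) ∈ I
  rw [project_map_component pb j (hI hf)]
  exact I.mul_mem_left _ hf

theorem project_map_mem_irrelevant (pb : PowerBasis F K) {r : ℕ}
    {x : MvPolynomial (Fin r × Fin pb.dim) F} (hx : x ∈ irrelevant F (Fin r × Fin pb.dim)) :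
    project pb r (map (algebraMap F K) x) ∈ irrelevant K (Fin r) := by
  have h : ∀ x : MvPolynomial (Fin r × Fin pb.dim) F,
      constantCoeff (project pb r (map (algebraMap F K) x)) =
        algebraMap F K (constantCoeff x) := by
    intro x
    refine congrFun (congrArg DFunLike.coe (MvPolynomial.ringHom_ext
      (f := constantCoeff.comp ((project pb r).toRingHom.comp (map (algebraMap F K))))
      (g := (algebraMap F K).comp constantCoeff) ?_ ?_)) x
    · intro a
      simp [project, algebraMap_eq]
    · intro i
      simp [project]
  rw [RingHom.mem_ker, h, RingHom.mem_ker.mp hx, map_zero]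

theorem project_map_mem_irrelevant_mul (pb : PowerBasis F K) {r : ℕ}
    {I : Ideal (MvPolynomial (Fin r) K)} (hI : I ≤ irrelevant K (Fin r))
    {x : MvPolynomial (Fin r × Fin pb.dim) F}
    (hx : x ∈ irrelevant F (Fin r × Fin pb.dim) * restriction pb I) :
    project pb r (map (algebraMap F K) x) ∈ irrelevant K (Fin r) * I := by
  induction hx using Submodule.mul_induction_on' with
  | mem_mul_mem m hm n hn =>
    rw [map_mul, map_mul]
    exact Ideal.mul_mem_mul (project_map_mem_irrelevant pb hm) (project_map_mem pb hI hn)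
  | add x _ y _ hx hy =>
    rw [map_add, map_add]
    exact Ideal.add_mem _ hx hy

/-- The components of a family independent modulo `𝔪I` are independent modulo `𝔫 Res(I)`. -/
theorem IndepMod.components (pb : PowerBasis F K) {r : ℕ} {ι : Type*} [Fintype ι]
    {I : Ideal (MvPolynomial (Fin r) K)} (hI : I ≤ irrelevant K (Fin r))
    {f : ι → MvPolynomial (Fin r) K} (hfI : ∀ i, f i ∈ I)
    (hf : IndepMod (irrelevant K (Fin r) * I) f) :
    IndepMod (irrelevant F (Fin r × Fin pb.dim) * restriction pb I)
      (WeilRes.components pb f) := by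
  intro c hc
  have h := hf (fun i => ∑ j, c (i, j) • pb.basis.traceDual j) (by
    convert project_map_mem_irrelevant_mul pb hI hc using 1
    rw [Fintype.sum_prod_type, map_sum, map_sum]
    refine Finset.sum_congr rfl fun i _ => ?_
    rw [map_sum, map_sum, map_sum, Finset.sum_mul]
    refine Finset.sum_congr rfl fun j _ => ?_
    rw [map_mul, map_mul, WeilRes.components, project_map_component pb j (hI (hfI i)), map_C,
      Algebra.smul_def, C_mul, mul_assoc]
    congr 1
    simp [project, algebraMap_eq])
  ext ⟨i, j⟩
  exact Fintype.linearIndependent_iff.mp pb.basis.traceDual.linearIndependent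
    (fun j => c (i, j)) (congrFun h i) j

theorem isMinHomogeneousGen_components (pb : PowerBasis F K) {r : ℕ} {ι : Type*} [Fintype ι]
    {I : Ideal (MvPolynomial (Fin r) K)} (hI : I ≤ irrelevant K (Fin r))
    {f : ι → MvPolynomial (Fin r) K} (hf : IsMinHomogeneousGen I f) :
    IsMinHomogeneousGen (restriction pb I) (components pb f) where
  toIsIrredundantGen := by
    refine IndepMod.isIrredundantGen ?_ (hf.indepMod.components pb hI fun i => ?_)
    · rw [restriction_span_range, hf.span_eq]
    · rw [← hf.span_eq]; exact Ideal.subset_span ⟨i, rfl⟩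
  homogeneous := fun ⟨i, j⟩ => (hf.homogeneous i).imp fun _ hd => isHomogeneous_component pb hd j

theorem card_totalDegree_components (pb : PowerBasis F K) {r : ℕ} {ι : Type*} [Fintype ι]
    {I : Ideal (MvPolynomial (Fin r) K)} (hI : I ≤ irrelevant K (Fin r))
    {f : ι → MvPolynomial (Fin r) K} (hf : IsMinHomogeneousGen I f) (d : ℕ) :
    Nat.card {p // (components pb f p).totalDegree = d} =
      pb.dim * Nat.card {i // (f i).totalDegree = d} := by
  have hdeg : ∀ p : ι × Fin pb.dim,
      (components pb f p).totalDegree = d ↔ (f p.1).totalDegree = d := by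
    rintro ⟨i, j⟩
    obtain ⟨e, he⟩ := hf.homogeneous i
    -- Nonvanishing matters on both sides: a zero polynomial would have `totalDegree` 0 whatever `e`
    -- is.
    rw [he.totalDegree (hf.indepMod.ne_zero i), components,
      (isHomogeneous_component pb he j).totalDegree
        ((isMinHomogeneousGen_components pb hI hf).indepMod.ne_zero (i, j))]
  rw [Nat.card_congr ((Equiv.subtypeEquivRight hdeg).trans
    (Equiv.prodSubtypeFstEquivSubtypeProd (p := fun i => (f i).totalDegree = d))), Nat.card_prod,
    Nat.card_eq_fintype_card (α := Fin pb.dim), Fintype.card_fin, mul_comm]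

/-- Since `f` need not be homogeneous, the bound passes through a minimal homogeneous family `h` of
`I`: the components of `h` are independent modulo `𝔫 Res(I)`, hence at most `n` in number, and `f`
is no longer than `h`. -/
theorem isMinCardGen_components (pb : PowerBasis F K) {r : ℕ} {ι : Type*} [Fintype ι]
    {I : Ideal (MvPolynomial (Fin r) K)}
    (hI : I.IsHomogeneous (homogeneousSubmodule (Fin r) K)) (hI' : I ≠ ⊤)
    {f : ι → MvPolynomial (Fin r) K} (hf : IsMinCardGen I f) :
    IsMinCardGen (restriction pb I) (components pb f) := by
  have hspan : Ideal.span (Set.range (components pb f)) = restriction pb I := by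
    rw [restriction_span_range, hf.span_eq]
  refine ⟨hspan, fun n g hg => ?_⟩
  obtain ⟨N, h, hh⟩ := exists_isMinHomogeneousGen hI
  have hmin := isMinHomogeneousGen_components pb (le_irrelevant hI hI') hh
  choose A hA using fun p => exists_sub_sum_mem hg (x := components pb h p)
    (hmin.span_eq ▸ Ideal.subset_span ⟨p, rfl⟩)
  have hle := hmin.indepMod.card_le A hA
  have hN := hf.card_le N h hh.span_eq
  rw [Fintype.card_prod, Fintype.card_fin, Fintype.card_fin, Fintype.card_fin] at hle
  rw [Fintype.card_prod, Fintype.card_fin]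
  exact (Nat.mul_le_mul_right _ hN).trans hle

end Main

end

end WeilRes

theorem mainTheorem2 {F K : Type*} [Field F] [Finite F] [Field K] [Finite K] [Algebra F K]
    (pb : PowerBasis F K) (r : ℕ) (I : Ideal (MvPolynomial (Fin r) K))
    (hI : I.IsHomogeneous (MvPolynomial.homogeneousSubmodule (Fin r) K)) (hI' : I ≠ ⊤) :
    (∀ (N : ℕ) (f : Fin N → MvPolynomial (Fin r) K), WeilRes.IsMinHomogeneousGen I f →
      WeilRes.IsMinHomogeneousGen (WeilRes.restriction pb I) (WeilRes.components pb f) ∧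
      (∀ i j d, (f i).IsHomogeneous d → (WeilRes.component pb j (f i)).IsHomogeneous d) ∧
      (∀ (M : ℕ) (g : Fin M → MvPolynomial (Fin r × Fin pb.dim) F),
        WeilRes.IsMinHomogeneousGen (WeilRes.restriction pb I) g →
        ∀ d : ℕ, Nat.card {k // (g k).totalDegree = d} =
          pb.dim * Nat.card {i // (f i).totalDegree = d})) ∧
    (∀ (N : ℕ) (f : Fin N → MvPolynomial (Fin r) K), WeilRes.IsMinCardGen I f →
      WeilRes.IsMinCardGen (WeilRes.restriction pb I) (WeilRes.components pb f)) := by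
  have hle := WeilRes.le_irrelevant hI hI'
  refine ⟨fun N f hf => ?_, fun N f hf => WeilRes.isMinCardGen_components pb hI hI' hf⟩
  have hmin := WeilRes.isMinHomogeneousGen_components pb hle hf
  refine ⟨hmin, fun i j d hd => WeilRes.isHomogeneous_component pb hd j, fun M g hg d => ?_⟩
  rw [hg.card_degree_eq hmin, WeilRes.card_totalDegree_components pb hle hf]
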